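/- Let $\Gamma=(V,E)$ be a finite simple graph with $N\ge 1$ edges $e_1,\dots,e_N$. Identify each edge $e_j$ with the interval $[0,1]$, so that one of its two end vertices corresponds to the parameter $0$ and the other one to the parameter $1$ (an arbitrary choice for each edge). For a vertex $v$ put $d_{v,j}=1$ if $v$ is the end of $e_j$ with parameter $1$, $d_{v,j}=-1$ if $v$ is the end of $e_j$ with parameter $0$, and $d_{v,j}=0$ if $v\notin e_j$. For $u=(u_1,\dots,u_N)$ and $v\in e_j$ let $u_j(v)$ and $u_j'(v)$ denote the values of $u_j:[0,1]\to\mathbb C$ and of its (one-sided) derivative at the parameter of $v$. Let $-\Delta$ be the operator $(u_j)_j\mapsto(-u_j'')_j$ in $C([0,1];\mathbb C)^N$ whose domain consists of all $u\in C^2([0,1];\mathbb C)^N$ satisfying the $KC$-condition (anti-Kirchhoff condition) $$\sum_{j=1}^N d_{v,j}^2\,u_j(v)=0\quad\text{for all }v\in V,\qquad d_{v,j}\,u_j'(v)=d_{v,s}\,u_s'(v)\quad\text{whenever } v\in e_j\cap e_s .$$ Then for every $\mu\in\mathbb C$ the geometric and the algebraic multiplicity of $\mu$ for $-\Delta$ coincide.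 Moreover, all eigenvalues of $-\Delta$ are real and, counted according to their multiplicities, they can be arranged in an infinite sequence $\lambda_1\le\lambda_2\le\cdots$; and this sequence satisfies $$\lim_{k\to\infty}\frac{\lambda_k}{k^2}=\frac{\pi^2}{N^2}.$$ -/

import Mathlib

open Set

noncomputable section

namespace KCGraph

/-! ### Multiplicities of eigenvalues of a partially defined linear operator -/

section Multiplicity

variable {X : Type*} [AddCommGroup X] [Module ℂ X]

/-- `genEigenspace T μ k` is the kernel of `(T - μ)^k`: it is `0` for `k = 0`, and `u` belongs to
`genEigenspace T μ (k + 1)` iff `u ∈ D(T)` and `T u - μ u ∈ genEigenspace T μ k`. -/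
def genEigenspace (T : X →ₗ.[ℂ] X) (μ : ℂ) : ℕ → Submodule ℂ X
  | 0 => ⊥
  | k + 1 => ((genEigenspace T μ k).comap (T.toFun - μ • T.domain.subtype)).map T.domain.subtype

/-- The eigenspace `{u ∈ D(T) | T u = μ u}`. -/
def eigenspace (T : X →ₗ.[ℂ] X) (μ : ℂ) : Submodule ℂ X := genEigenspace T μ 1

theorem mem_eigenspace {T : X →ₗ.[ℂ] X} {μ : ℂ} {u : X} :
    u ∈ eigenspace T μ ↔ ∃ h : u ∈ T.domain, T ⟨u, h⟩ = μ • u := by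
  simp [eigenspace, genEigenspace, sub_eq_zero]

/-- The geometric multiplicity of `μ` (it is `0` iff `μ` is not an eigenvalue). -/
def geomMult (T : X →ₗ.[ℂ] X) (μ : ℂ) : ℕ∞ :=
  Cardinal.toENat (Module.rank ℂ (eigenspace T μ))

/-- The algebraic multiplicity of `μ`: the dimension of the space of all generalized
eigenvectors. -/
def algMult (T : X →ₗ.[ℂ] X) (μ : ℂ) : ℕ∞ :=
  Cardinal.toENat (Module.rank ℂ (⨆ k, genEigenspace T μ k : Submodule ℂ X))

/-- `lam 0 ≤ lam 1 ≤ ⋯` lists all eigenvalues of `T`, each repeated according to its geometric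
multiplicity; `lam k` is the `(k + 1)`-st eigenvalue. Since `μ` ranges over `ℂ`, this includes
that all eigenvalues are real. -/
structure IsEigenvalueSequence (T : X →ₗ.[ℂ] X) (lam : ℕ → ℝ) : Prop where
  monotone : Monotone lam
  encard_eq : ∀ μ : ℂ, {k : ℕ | (lam k : ℂ) = μ}.encard = geomMult T μ

end Multiplicity

/-! ### Functions of class `C²` on the closed unit interval -/

/-- The extension of `f : [0,1] → ℂ` to the line (only its restriction to `[0,1]` matters). -/
def lineExt (f : C(unitInterval, ℂ)) : ℝ → ℂ := IccExtend zero_le_one f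

/-- `f ∈ C²[0,1]`, with one-sided derivatives at the end points. -/
def IsC2 (f : C(unitInterval, ℂ)) : Prop := ContDiffOn ℝ 2 (lineExt f) (Icc 0 1)

/-- `f'(x)`, one-sided at the end points. -/
def der (f : C(unitInterval, ℂ)) (x : unitInterval) : ℂ := derivWithin (lineExt f) (Icc 0 1) x

theorem lineExt_add (f g : C(unitInterval, ℂ)) : lineExt (f + g) = lineExt f + lineExt g := rfl

theorem lineExt_smul (c : ℂ) (f : C(unitInterval, ℂ)) : lineExt (c • f) = c • lineExt f := rfl

theorem IsC2.add {f g : C(unitInterval, ℂ)} (hf : IsC2 f) (hg : IsC2 g) : IsC2 (f + g) := by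
  unfold IsC2; rw [lineExt_add]; exact ContDiffOn.add hf hg

theorem IsC2.smul {f : C(unitInterval, ℂ)} (c : ℂ) (hf : IsC2 f) : IsC2 (c • f) := by
  unfold IsC2; rw [lineExt_smul]; exact ContDiffOn.const_smul c hf

theorem isC2_zero : IsC2 0 := by
  have h : lineExt 0 = fun _ => (0 : ℂ) := rfl
  unfold IsC2; rw [h]; exact contDiffOn_const

theorem IsC2.differentiableWithinAt {f : C(unitInterval, ℂ)} (hf : IsC2 f) (x : unitInterval) :
    DifferentiableWithinAt ℝ (lineExt f) (Icc 0 1) x :=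
  ContDiffOn.differentiableOn hf (by norm_num) x x.2

theorem der_add {f g : C(unitInterval, ℂ)} (hf : IsC2 f) (hg : IsC2 g) (x : unitInterval) :
    der (f + g) x = der f x + der g x := by
  unfold der; rw [lineExt_add]
  exact derivWithin_add (hf.differentiableWithinAt x) (hg.differentiableWithinAt x)

theorem der_smul {f : C(unitInterval, ℂ)} (c : ℂ) (hf : IsC2 f) (x : unitInterval) :
    der (c • f) x = c * der f x := by
  unfold der; rw [lineExt_smul]
  exact derivWithin_const_smul c (hf.differentiableWithinAt x)

theorem der_zero (x : unitInterval) : der 0 x = 0 := by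
  have h : lineExt 0 = fun _ => (0 : ℂ) := rfl
  unfold der; rw [h]; simp

/-- `f''` as a continuous function on `[0,1]`, for `f ∈ C²[0,1]`. -/
def der2 (f : C(unitInterval, ℂ)) (hf : IsC2 f) : C(unitInterval, ℂ) where
  toFun x := iteratedDerivWithin 2 (lineExt f) (Icc 0 1) x
  continuous_toFun := continuousOn_iff_continuous_domRestrict.1
    (ContDiffOn.continuousOn_iteratedDerivWithin hf le_rfl (uniqueDiffOn_Icc zero_lt_one))

/-! ### Oriented graphs and the anti-Kirchhoff condition -/

/-- A parametrization of the edges of `Γ` by `[0,1]`, up to the choice of curves: the edge `e` runs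
from `tail e` (parameter `0`) to `head e` (parameter `1`). -/
structure Orientation {V : Type*} (Γ : SimpleGraph V) where
  tail : Γ.edgeSet → V
  head : Γ.edgeSet → V
  edge_eq : ∀ e : Γ.edgeSet, s(tail e, head e) = (e : Sym2 V)

variable {V : Type*} [Fintype V] [DecidableEq V] {Γ : SimpleGraph V} [DecidableRel Γ.Adj]

/-- The signed incidence matrix `d`: `1` at the head, `-1` at the tail, `0` otherwise. -/
def Orientation.d (o : Orientation Γ) (v : V) (e : Γ.edgeSet) : ℂ :=
  if o.head e = v then 1 else if o.tail e = v then -1 else 0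

/-- The parameter in `[0,1]` of the vertex `v` on the edge `e` (meaningful if `v ∈ e`). -/
def Orientation.pos (o : Orientation Γ) (v : V) (e : Γ.edgeSet) : unitInterval :=
  if o.head e = v then 1 else 0

/-- The space `C[0,1]^N` of families of continuous functions, one for each edge. -/
abbrev EdgeFun (Γ : SimpleGraph V) : Type _ := Γ.edgeSet → C(unitInterval, ℂ)

/-- The domain of `Δ`: families `u ∈ C²[0,1]^N` that satisfy the `KC`-condition, i.e. at each vertex
the values sum up to `0`, and the outer normal derivatives along all incident edges agree. -/
def kcDomain (o : Orientation Γ) : Submodule ℂ (EdgeFun Γ) where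
  carrier := {u | (∀ e, IsC2 (u e)) ∧
    (∀ v, ∑ e, o.d v e ^ 2 * u e (o.pos v e) = 0) ∧
    (∀ v, ∀ e f : Γ.edgeSet, v ∈ (e : Sym2 V) → v ∈ (f : Sym2 V) →
      o.d v e * der (u e) (o.pos v e) = o.d v f * der (u f) (o.pos v f))}
  add_mem' := by
    rintro u w ⟨hu, hu1, hu2⟩ ⟨hw, hw1, hw2⟩
    refine ⟨fun e => (hu e).add (hw e), fun v => ?_, fun v e f he hf => ?_⟩
    · simp [mul_add, Finset.sum_add_distrib, hu1 v, hw1 v]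
    · simp only [Pi.add_apply]
      rw [der_add (hu e) (hw e), der_add (hu f) (hw f), mul_add, mul_add, hu2 v e f he hf,
        hw2 v e f he hf]
  zero_mem' := ⟨fun _ => isC2_zero, by simp, by simp [der_zero]⟩
  smul_mem' := by
    rintro c u ⟨hu, hu1, hu2⟩
    refine ⟨fun e => (hu e).smul c, fun v => ?_, fun v e f he hf => ?_⟩
    · have : ∀ e, o.d v e ^ 2 * (c • u) e (o.pos v e) = c * (o.d v e ^ 2 * u e (o.pos v e)) := by
        intro e; simp; ring
      simp only [this, ← Finset.mul_sum, hu1 v, mul_zero]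
    · simp only [Pi.smul_apply]
      rw [der_smul c (hu e), der_smul c (hu f), mul_left_comm, hu2 v e f he hf, mul_left_comm]

/-- The operator `-Δ : u ↦ (-u_e'')_e` in `C[0,1]^N`, under the `KC`-condition. -/
def negLaplacianKC (o : Orientation Γ) : EdgeFun Γ →ₗ.[ℂ] EdgeFun Γ where
  domain := kcDomain o
  toFun :=
    { toFun := fun u e => -der2 (u.1 e) (u.2.1 e)
      map_add' := by
        intro u w
        funext e
        ext x
        have h := iteratedDerivWithin_add x.2 (uniqueDiffOn_Icc zero_lt_one)
          (ContDiffOn.contDiffWithinAt (u.2.1 e) x.2) (ContDiffOn.contDiffWithinAt (w.2.1 e) x.2)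
        have h' : der2 ((u + w).1 e) ((u + w).2.1 e) x
            = der2 (u.1 e) (u.2.1 e) x + der2 (w.1 e) (w.2.1 e) x := h
        simp only [Pi.add_apply, ContinuousMap.add_apply, ContinuousMap.neg_apply, h', neg_add]
      map_smul' := by
        intro c u
        funext e
        ext x
        have h := iteratedDerivWithin_const_smul x.2 (uniqueDiffOn_Icc zero_lt_one) c
          (ContDiffOn.contDiffWithinAt (u.2.1 e) x.2)
        have h' : der2 ((c • u).1 e) ((c • u).2.1 e) x = c • der2 (u.1 e) (u.2.1 e) x := h
        simp only [Pi.smul_apply, ContinuousMap.smul_apply, ContinuousMap.neg_apply, h', smul_neg,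
          RingHom.id_apply] }

end KCGraph

end

/-! On an edge, the solutions of `-f'' = κ² f` with `κ ≠ 0` are `a exp(iκx) + b exp(iκ(1-x))`, so a
candidate eigenfunction is a vector of `2N` amplitudes, one for each dart (an edge with a chosen
starting end). At the start of a dart `δ` its value is `c δ + z c(ρδ)` and its outer normal
derivative is `iκ(z c(ρδ) - c δ)`, where `z = exp(iκ)` and `ρ` reverses darts. The anti-Kirchhoff
condition then says exactly `S c = z⁻¹ c`, where `S` reverses darts and then subtracts twice the
vertex average. This `S` is unitary and does not depend on `κ` (`mem_eigenspace_scattering_iff`,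
`preservesForm_scattering`).

A unitary map of `ℂ^(2N)` has `2N` eigenvalues `exp(-iθ_j)` on the unit circle, and their geometric
and algebraic multiplicities agree (`PreservesForm.exists_angles`). Hence the positive frequencies,
with multiplicity, are the `2N` progressions `θ_j + 2πq`. The `i`-th one differs from `πi/N` by at
most `2π`, and the eigenvalue `0`, of finite multiplicity, only shifts the index. Squaring gives the
limit `π²/N²`.

Green's formula gives the rest: its boundary terms cancel vertex by vertex (`sum_boundary_eq_zero`),
so all eigenvalues are real and nonnegative and there are no proper generalized eigenfunctions. No
integral is needed: the integrand is nonnegative and has a primitive with equal values at `0` and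
`1`, hence vanishes (`deriv_eq_zero_of_nonneg_of_endpoints_eq`). -/

noncomputable section

namespace KCGraph

/-! ### Calculus on the unit interval -/

section Calculus

/-- A nonnegative derivative of a function that agrees at the two end points vanishes. -/
theorem deriv_eq_zero_of_nonneg_of_endpoints_eq {G g : ℝ → ℝ}
    (hG : ∀ x ∈ Icc (0 : ℝ) 1, HasDerivWithinAt G (g x) (Icc 0 1) x)
    (hg : ∀ x ∈ Icc (0 : ℝ) 1, 0 ≤ g x) (h01 : G 0 = G 1) : ∀ x ∈ Icc (0 : ℝ) 1, g x = 0 := by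
  have hmono : MonotoneOn G (Icc 0 1) := by
    refine monotoneOn_of_hasDerivWithinAt_nonneg (f' := g) (convex_Icc 0 1)
      (fun x hx => (hG x hx).continuousWithinAt)
      (fun x hx => (hG x (interior_subset hx)).mono interior_subset)
      (fun x hx => hg x (interior_subset hx))
  have hconst : ∀ x ∈ Icc (0 : ℝ) 1, G x = G 0 := fun x hx =>
    le_antisymm (h01 ▸ hmono hx (right_mem_Icc.2 zero_le_one) hx.2)
      (hmono (left_mem_Icc.2 zero_le_one) hx hx.1)
  intro x hx
  exact (uniqueDiffOn_Icc zero_lt_one x hx).eq_deriv _ (hG x hx)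
    ((hasDerivWithinAt_const x (Icc 0 1) (G 0)).congr hconst (hconst x hx))

theorem lineExt_apply (f : C(unitInterval, ℂ)) {x : ℝ} (hx : x ∈ Icc (0 : ℝ) 1) :
    lineExt f x = f ⟨x, hx⟩ := IccExtend_of_mem _ _ hx

/-- The derivative of `lineExt f` within `[0,1]`. -/
def lineDer (f : C(unitInterval, ℂ)) : ℝ → ℂ := derivWithin (lineExt f) (Icc 0 1)

theorem der_eq_lineDer (f : C(unitInterval, ℂ)) (x : unitInterval) : der f x = lineDer f x := rfl

theorem IsC2.hasDerivWithinAt {f : C(unitInterval, ℂ)} (hf : IsC2 f) {x : ℝ}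
    (hx : x ∈ Icc (0 : ℝ) 1) : HasDerivWithinAt (lineExt f) (lineDer f x) (Icc 0 1) x :=
  (hf.differentiableWithinAt ⟨x, hx⟩).hasDerivWithinAt

theorem IsC2.hasDerivWithinAt_lineDer {f : C(unitInterval, ℂ)} (hf : IsC2 f) {x : ℝ}
    (hx : x ∈ Icc (0 : ℝ) 1) :
    HasDerivWithinAt (lineDer f) (der2 f hf ⟨x, hx⟩) (Icc 0 1) x := by
  have hd : DifferentiableOn ℝ (lineDer f) (Icc 0 1) := by
    have := (contDiffOn_succ_iff_derivWithin (n := 1) (uniqueDiffOn_Icc zero_lt_one)).1 hf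
    exact this.2.2.differentiableOn (by norm_num)
  have h := (hd x hx).hasDerivWithinAt
  have e : der2 f hf ⟨x, hx⟩ = derivWithin (lineDer f) (Icc 0 1) x := by
    change iteratedDerivWithin 2 (lineExt f) (Icc 0 1) x = _
    rw [iteratedDerivWithin_succ]
    refine derivWithin_congr (fun y hy => ?_) ?_
    · rw [iteratedDerivWithin_one]; rfl
    · rw [iteratedDerivWithin_one]; rfl
  rwa [e]

/-- The restriction to the unit interval of a function on the line. -/
def restrictUnit (F : ℝ → ℂ) (hF : Continuous F) : C(unitInterval, ℂ) :=
  ⟨fun x => F x, hF.comp continuous_subtype_val⟩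

theorem eqOn_lineExt_restrictUnit (F : ℝ → ℂ) (hF : Continuous F) :
    EqOn (lineExt (restrictUnit F hF)) F (Icc 0 1) := fun _ hx => lineExt_apply _ hx

theorem isC2_restrictUnit {F : ℝ → ℂ} (hF : ContDiff ℝ 2 F) :
    IsC2 (restrictUnit F hF.continuous) :=
  hF.contDiffOn.congr (eqOn_lineExt_restrictUnit _ _)

theorem der_restrictUnit {F : ℝ → ℂ} (hF : Continuous F) {F' : ℂ} {x : unitInterval}
    (h : HasDerivAt F F' (x : ℝ)) : der (restrictUnit F hF) x = F' :=
  (h.hasDerivWithinAt.congr (eqOn_lineExt_restrictUnit F hF)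
    (eqOn_lineExt_restrictUnit F hF x.2)).derivWithin (uniqueDiffOn_Icc zero_lt_one x x.2)

theorem der2_restrictUnit {F F' F'' : ℝ → ℂ} (hF : ContDiff ℝ 2 F)
    (h : ∀ x, HasDerivAt F (F' x) x) (h' : ∀ x, HasDerivAt F' (F'' x) x) (x : unitInterval) :
    der2 (restrictUnit F hF.continuous) (isC2_restrictUnit hF) x = F'' x := by
  have e : ∀ y ∈ Icc (0 : ℝ) 1, lineDer (restrictUnit F hF.continuous) y = F' y := fun y hy =>
    der_restrictUnit hF.continuous (x := ⟨y, hy⟩) (h y)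
  exact (uniqueDiffOn_Icc zero_lt_one x x.2).eq_deriv _
    ((isC2_restrictUnit hF).hasDerivWithinAt_lineDer x.2)
    ((h' x).hasDerivWithinAt.congr e (e x x.2))

/-- A function with vanishing derivative on `[0,1]` is constant there. -/
theorem eq_left_of_hasDerivWithinAt_zero {F : ℝ → ℂ}
    (hF : ∀ x ∈ Icc (0 : ℝ) 1, HasDerivWithinAt F 0 (Icc 0 1) x) :
    ∀ x ∈ Icc (0 : ℝ) 1, F x = F 0 :=
  constant_of_derivWithin_zero (fun x hx => (hF x hx).differentiableWithinAt)
    fun x hx => (hF x (Ico_subset_Icc_self hx)).derivWithin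
      (uniqueDiffOn_Icc zero_lt_one x (Ico_subset_Icc_self hx))

/-- The superposition of two waves of frequency `κ`, with amplitudes `a` outgoing at `0` and `b`
outgoing at `1`. -/
def waveLine (κ : ℝ) (a b : ℂ) (x : ℝ) : ℂ :=
  a * Complex.exp (Complex.I * κ * x) + b * Complex.exp (Complex.I * κ * (1 - x))

theorem hasDerivAt_exp_mul (c : ℂ) (x : ℝ) :
    HasDerivAt (fun x : ℝ => Complex.exp (c * x)) (c * Complex.exp (c * x)) x := by
  have h : HasDerivAt (fun x : ℝ => c * (x : ℂ)) c x := by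
    simpa using (Complex.ofRealCLM.hasDerivAt (x := x)).const_mul c
  simpa [mul_comm] using h.cexp

theorem hasDerivAt_exp_mul_one_sub (c : ℂ) (x : ℝ) :
    HasDerivAt (fun x : ℝ => Complex.exp (c * (1 - x))) (-(c * Complex.exp (c * (1 - x)))) x := by
  have h : HasDerivAt (fun x : ℝ => c * (1 - (x : ℂ))) (-c) x := by
    simpa using ((Complex.ofRealCLM.hasDerivAt (x := x)).const_sub 1).const_mul c
  have := h.cexp
  convert this using 1
  ring

theorem hasDerivAt_waveLine (κ : ℝ) (a b : ℂ) (x : ℝ) :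
    HasDerivAt (waveLine κ a b)
      (waveLine κ (Complex.I * κ * a) (-(Complex.I * κ * b)) x) x := by
  have := ((hasDerivAt_exp_mul (Complex.I * κ) x).const_mul a).add
    ((hasDerivAt_exp_mul_one_sub (Complex.I * κ) x).const_mul b)
  refine this.congr_deriv ?_
  simp only [waveLine]; ring

theorem contDiff_waveLine (κ : ℝ) (a b : ℂ) : ContDiff ℝ 2 (waveLine κ a b) := by
  have h : ContDiff ℝ 2 (fun x : ℝ => (x : ℂ)) := Complex.ofRealCLM.contDiff
  unfold waveLine
  fun_prop

/-- `waveLine` as a continuous function on the unit interval. -/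
def wave (κ : ℝ) (a b : ℂ) : C(unitInterval, ℂ) :=
  restrictUnit (waveLine κ a b) (contDiff_waveLine κ a b).continuous

theorem isC2_wave (κ : ℝ) (a b : ℂ) : IsC2 (wave κ a b) :=
  isC2_restrictUnit (contDiff_waveLine κ a b)

theorem wave_apply (κ : ℝ) (a b : ℂ) (x : unitInterval) : wave κ a b x = waveLine κ a b x := rfl

theorem der_wave (κ : ℝ) (a b : ℂ) (x : unitInterval) :
    der (wave κ a b) x = waveLine κ (Complex.I * κ * a) (-(Complex.I * κ * b)) x :=
  der_restrictUnit _ (hasDerivAt_waveLine κ a b x)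

theorem der2_wave (κ : ℝ) (a b : ℂ) (x : unitInterval) :
    -der2 (wave κ a b) (isC2_wave κ a b) x = (κ : ℂ) ^ 2 * wave κ a b x := by
  have := der2_restrictUnit (contDiff_waveLine κ a b) (hasDerivAt_waveLine κ a b)
    (hasDerivAt_waveLine κ _ _) x
  rw [wave_apply]
  unfold wave
  rw [this]
  simp only [waveLine]
  linear_combination (-(κ : ℂ) ^ 2 * (a * Complex.exp (Complex.I * κ * x)
    + b * Complex.exp (Complex.I * κ * (1 - x)))) * Complex.I_sq

/-- Every solution of `-f'' = κ² f` is a superposition of waves. -/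
theorem exists_eq_wave {f : C(unitInterval, ℂ)} (hf : IsC2 f) {κ : ℝ} (hκ : κ ≠ 0)
    (h : ∀ x, -der2 f hf x = (κ : ℂ) ^ 2 * f x) : ∃ a b, f = wave κ a b := by
  have hκ' : (κ : ℂ) ≠ 0 := by exact_mod_cast hκ
  -- Factoring the equation as `(d/dx - c)(d/dx + c) f = 0` makes `exp(-cx)` an integrating factor
  -- for `f' + c f`. The choices `c = ±iκ` give two linear equations for `f` and `f'`.
  have key : ∀ c : ℂ, c ^ 2 = -(κ : ℂ) ^ 2 → ∀ x ∈ Icc (0 : ℝ) 1,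
      Complex.exp (-c * x) * (lineDer f x + c * lineExt f x)
        = lineDer f 0 + c * lineExt f 0 := by
    intro c hc x hx
    have := eq_left_of_hasDerivWithinAt_zero
      (F := fun x => Complex.exp (-c * x) * (lineDer f x + c * lineExt f x)) (fun y hy => by
        have h1 := (hf.hasDerivWithinAt_lineDer hy).add ((hf.hasDerivWithinAt hy).const_mul c)
        refine ((hasDerivAt_exp_mul (-c) y).hasDerivWithinAt.mul h1).congr_deriv ?_
        simp only [Pi.add_apply]
        have h2 := h ⟨y, hy⟩
        rw [← lineExt_apply f hy] at h2
        linear_combination -Complex.exp (-c * y) * h2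
          - Complex.exp (-c * y) * lineExt f y * hc) x hx
    simpa using this
  have hI : (Complex.I * κ) ^ 2 = -(κ : ℂ) ^ 2 := by rw [mul_pow, Complex.I_sq]; ring
  set A := lineDer f 0 + Complex.I * κ * lineExt f 0
  set B := lineDer f 0 + -(Complex.I * κ) * lineExt f 0
  -- Subtracting the two equations eliminates `f'`. The factor `exp(-iκ)` appears because the second
  -- amplitude is normalized at the end `1`.
  refine ⟨A / (2 * Complex.I * κ),
    -B / (2 * Complex.I * κ) * Complex.exp (-(Complex.I * κ)), ?_⟩
  ext x
  have h1 := key (Complex.I * κ) hI x x.2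
  have h2 := key (-(Complex.I * κ)) (by rw [neg_sq, hI]) x x.2
  rw [lineExt_apply f x.2] at h1 h2
  have e1 : Complex.exp (Complex.I * κ * x) * Complex.exp (-(Complex.I * κ) * x) = 1 := by
    rw [← Complex.exp_add]; simp
  have e2 : Complex.exp (-(Complex.I * κ)) * Complex.exp (Complex.I * κ * (1 - x))
      = Complex.exp (-(Complex.I * κ) * x) := by
    rw [← Complex.exp_add]; congr 1; ring
  rw [wave_apply, waveLine, mul_assoc _ (Complex.exp (-(Complex.I * κ))), e2]
  rw [neg_neg] at h2
  change _ = A at h1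
  change _ = B at h2
  rw [← h1, ← h2]
  rw [neg_mul] at e1 ⊢
  field_simp
  linear_combination (-2 * Complex.I * κ * f x) * e1

theorem waveLine_zero (κ : ℝ) (a b : ℂ) :
    waveLine κ a b 0 = a + b * Complex.exp (Complex.I * κ) := by simp [waveLine]

theorem waveLine_one (κ : ℝ) (a b : ℂ) :
    waveLine κ a b 1 = a * Complex.exp (Complex.I * κ) + b := by simp [waveLine]

/-- A wave determines its amplitudes. -/
theorem wave_eq_zero {κ : ℝ} (hκ : κ ≠ 0) {a b : ℂ} (h : wave κ a b = 0) : a = 0 ∧ b = 0 := by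
  have hκ' : (κ : ℂ) ≠ 0 := by exact_mod_cast hκ
  have h0 : waveLine κ a b 0 = 0 := by
    simpa [wave_apply] using DFunLike.congr_fun h (0 : unitInterval)
  have h1 : waveLine κ (Complex.I * κ * a) (-(Complex.I * κ * b)) 0 = 0 := by
    have := der_wave κ a b 0
    rw [h, der_zero] at this
    simpa using this.symm
  rw [waveLine_zero] at h0 h1
  have hb : b * Complex.exp (Complex.I * κ) = 0 := by
    have : 2 * (Complex.I * κ) * (b * Complex.exp (Complex.I * κ)) = 0 := by
      linear_combination Complex.I * κ * h0 - h1
    simpa [hκ'] using this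
  exact ⟨by linear_combination h0 - hb, by simpa using hb⟩

end Calculus

/-! ### Unitary endomorphisms of `ℂ^D` -/

section Unitary

open Module Matrix
open scoped ComplexOrder

variable {D : Type*} [Fintype D]

/-- An endomorphism of `ℂ^D` that preserves the standard Hermitian form. -/
def PreservesForm (T : End ℂ (D → ℂ)) : Prop := ∀ a b, star (T a) ⬝ᵥ T b = star a ⬝ᵥ b

theorem PreservesForm.star_mul_self {T : End ℂ (D → ℂ)} (hT : PreservesForm T) {μ : ℂ}
    {w : D → ℂ} (hw : T w = μ • w) (h0 : w ≠ 0) : star μ * μ = 1 := by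
  have h := hT w w
  rw [hw, star_smul, smul_dotProduct, dotProduct_smul, smul_eq_mul, smul_eq_mul, ← mul_assoc] at h
  exact mul_right_cancel₀ (mt dotProduct_star_self_eq_zero.1 h0) (by rw [h, one_mul])

/-- If `w = (T - μ)c` were a nonzero eigenvector, then `|μ| = 1`, and comparing `⟨Tw, Tc⟩` with `⟨w,
c⟩` would leave `star μ * ⟨w, w⟩ = 0`. So Jordan chains have length one. -/
theorem PreservesForm.eigenspace_eq {T : End ℂ (D → ℂ)} (hT : PreservesForm T) (μ : ℂ) :
    T.maxGenEigenspace μ = T.eigenspace μ := by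
  have step : ∀ c, (T - μ • 1) ((T - μ • 1) c) = 0 → (T - μ • 1) c = 0 := by
    intro c hc
    set w := (T - μ • 1) c with hw
    by_contra h0
    have hTw : T w = μ • w := by simpa [sub_eq_zero] using hc
    have hμ := hT.star_mul_self hTw h0
    have hμ0 : star μ ≠ 0 := left_ne_zero_of_mul_eq_one hμ
    have hTc : T c = w + μ • c := by simp [hw]
    have h := hT w c
    rw [hTw, hTc, star_smul, smul_dotProduct, dotProduct_add, dotProduct_smul, smul_eq_mul,
      smul_eq_mul, mul_add, ← mul_assoc, hμ, one_mul, add_eq_right] at h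
    exact h0 (dotProduct_star_self_eq_zero.1 ((mul_eq_zero.1 h).resolve_left hμ0))
  refine le_antisymm (fun c hc => ?_) End.eigenspace_le_maxGenEigenspace
  obtain ⟨k, hk⟩ := (End.mem_maxGenEigenspace _ _ _).1 hc
  have key : ∀ (k : ℕ) (c : D → ℂ), ((T - μ • (1 : End ℂ (D → ℂ))) ^ (k + 1)) c = 0 → (T - μ • 1) c = 0 := by
    intro k
    induction k with
    | zero => intro c h; simpa using h
    | succ k ih =>
      intro c h
      rw [pow_succ, Module.End.mul_apply] at h
      exact step c (ih _ h)
  have := key k c (by rw [pow_succ', Module.End.mul_apply, hk, map_zero])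
  rw [End.mem_eigenspace_iff]
  simpa [sub_eq_zero] using this

/-- The eigenvalues of a unitary endomorphism, written as `exp (-iθ)` with `0 < θ ≤ 2π` and arranged
in nondecreasing order of `θ`. -/
theorem PreservesForm.exists_angles {T : End ℂ (D → ℂ)} (hT : PreservesForm T) :
    ∃ θ : Fin (Fintype.card D) → ℝ, Monotone θ ∧ (∀ j, θ j ∈ Ioc 0 (2 * Real.pi)) ∧
      ∀ t ∈ Ioc 0 (2 * Real.pi), {j | θ j = t}.ncard
        = finrank ℂ (T.eigenspace (Complex.exp (-(Complex.I * t)))) := by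
  classical
  -- The interval `(0, 2π]` assigns the angle `2π`, not `0`, to the eigenvalue `1`; this keeps every
  -- frequency `θ + 2πq` with `q ≥ 0` positive.
  set angle : ℂ → ℝ := fun ζ => toIocMod Real.two_pi_pos 0 (-Complex.arg ζ) with hangle
  have angle_mem : ∀ ζ, angle ζ ∈ Ioc 0 (2 * Real.pi) := fun ζ => by
    simpa using toIocMod_mem_Ioc Real.two_pi_pos 0 (-Complex.arg ζ)
  have exp_angle : ∀ ζ : ℂ, ‖ζ‖ = 1 → Complex.exp (-(Complex.I * angle ζ)) = ζ := by
    intro ζ hζ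
    have h1 : Complex.exp (Complex.arg ζ * Complex.I) = ζ := by
      simpa [hζ] using Complex.norm_mul_exp_arg_mul_I ζ
    have h2 : angle ζ = -Complex.arg ζ - toIocDiv Real.two_pi_pos 0 (-Complex.arg ζ) • (2 * Real.pi) :=
      rfl
    rw [h2]
    conv_rhs => rw [← h1]
    rw [Complex.exp_eq_exp_iff_exists_int]
    refine ⟨toIocDiv Real.two_pi_pos 0 (-Complex.arg ζ), ?_⟩
    push_cast [zsmul_eq_mul]
    ring
  have angle_exp : ∀ t ∈ Ioc 0 (2 * Real.pi), angle (Complex.exp (-(Complex.I * t))) = t := by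
    intro t ht
    have hm := angle_mem (Complex.exp (-(Complex.I * t)))
    have he := exp_angle (Complex.exp (-(Complex.I * t)))
      (by rw [Complex.norm_exp]; simp)
    obtain ⟨n, hn⟩ := Complex.exp_eq_exp_iff_exists_int.1 he
    set s := angle (Complex.exp (-(Complex.I * t)))
    have hst : s = t - n * (2 * Real.pi) := by
      have : (s : ℂ) = ((t - n * (2 * Real.pi) : ℝ) : ℂ) := by
        apply mul_left_cancel₀ Complex.I_ne_zero
        push_cast
        linear_combination -hn
      exact_mod_cast this
    have hpi := Real.two_pi_pos
    have hn1 : (n : ℝ) < 1 := by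
      by_contra h; push Not at h; nlinarith [hm.1, ht.2]
    have hn2 : (-1 : ℝ) < n := by
      by_contra h; push Not at h; nlinarith [hm.2, ht.1]
    have hn0 : n = 0 := by
      have h1 : n < 1 := by exact_mod_cast hn1
      have h2 : -1 < n := by exact_mod_cast hn2
      omega
    rw [hst, hn0]; simp
  set R := T.charpoly.roots with hR
  have hcard : R.card = Fintype.card D := by
    rw [hR, (Polynomial.splits_iff_card_roots).1 (IsAlgClosed.splits _),
      LinearMap.charpoly_natDegree, Module.finrank_fintype_fun_eq_card]
  have norm_root : ∀ ζ ∈ R, ‖ζ‖ = 1 := by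
    intro ζ hζ
    have hev : T.HasEigenvalue ζ := by
      rw [End.hasEigenvalue_iff_isRoot_charpoly]
      exact Polynomial.isRoot_of_mem_roots hζ
    obtain ⟨w, hw⟩ := hev.exists_hasEigenvector
    have h := hT.star_mul_self hw.apply_eq_smul hw.2
    have h' := congrArg norm h
    rw [norm_mul, norm_star, norm_one] at h'
    nlinarith [norm_nonneg ζ]
  set L := (R.map angle).sort (· ≤ ·) with hL
  have hlen : L.length = Fintype.card D := by simp [hL, hcard]
  refine ⟨fun j => L.get (j.cast hlen.symm), ?_, ?_, ?_⟩
  · intro i j hij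
    have hs : L.SortedLE := List.sortedLE_iff_pairwise.2 (Multiset.pairwise_sort _ _)
    exact hs.monotone_get (by simpa using hij)
  · intro j
    have : L.get (j.cast hlen.symm) ∈ R.map angle := by
      rw [← Multiset.mem_sort (· ≤ ·)]; exact List.get_mem _ _
    obtain ⟨ζ, -, hζ⟩ := Multiset.mem_map.1 this
    exact Set.mem_of_eq_of_mem hζ.symm (angle_mem ζ)
  · intro t ht
    have h1 : {j : Fin (Fintype.card D) | L.get (j.cast hlen.symm) = t}.ncard = L.count t := by
      rw [← Finset.coe_filter_univ, Set.ncard_coe_finset]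
      exact Fin.card_filter_univ_eq_vector_get_eq_count t ⟨L, hlen⟩
    have h2 : L.count t = (R.map angle).count t := by
      rw [← Multiset.coe_count, hL, Multiset.sort_eq]
    have h3 : (R.map angle).count t = R.count (Complex.exp (-(Complex.I * t))) := by
      rw [Multiset.count_map, Multiset.count_eq_card_filter_eq]
      congr 1
      refine Multiset.filter_congr fun ζ hζ => ⟨fun h => ?_, fun h => ?_⟩
      · rw [h]; exact exp_angle ζ (norm_root ζ hζ)
      · rw [← h, angle_exp t ht]
    -- The multiplicity as a root of the characteristic polynomial is the dimension of the
    -- generalized eigenspace, which here is the eigenspace.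
    rw [h1, h2, h3, ← hT.eigenspace_eq, LinearMap.finrank_maxGenEigenspace_eq, hR,
      Polynomial.count_roots]

end Unitary

/-! ### The scattering endomorphism -/

section Scattering

open Module Matrix

variable {D V : Type*} [Fintype D] [DecidableEq V]

/-- The darts `δ` of a graph start at the vertices `s δ`, and `ρ` turns them around. A wave that
leaves along the reversed darts with amplitudes `c` is scattered at each vertex by subtracting twice
the average over the vertex. -/
def scattering (s : D → V) (ρ : Equiv.Perm D) : End ℂ (D → ℂ) where
  toFun c δ := c (ρ δ) - 2 / (Finset.card {δ' | s δ' = s δ} : ℂ) * ∑ δ' with s δ' = s δ, c (ρ δ')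
  map_add' a b := by
    funext δ
    simp only [Pi.add_apply, Finset.sum_add_distrib]
    ring
  map_smul' r a := by
    funext δ
    simp only [Pi.smul_apply, smul_eq_mul, RingHom.id_apply, ← Finset.mul_sum]
    ring

theorem scattering_apply (s : D → V) (ρ : Equiv.Perm D) (c : D → ℂ) (δ : D) :
    scattering s ρ c δ = c (ρ δ)
      - 2 / (Finset.card {δ' | s δ' = s δ} : ℂ) * ∑ δ' with s δ' = s δ, c (ρ δ') := rfl

omit [Fintype D] in
/-- Subtracting twice the average is a reflection. -/
theorem sum_star_mul_sub_two_average (F : Finset D) (a b : D → ℂ) :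
    ∑ δ ∈ F, star (a δ - 2 / (F.card : ℂ) * ∑ δ' ∈ F, a δ')
      * (b δ - 2 / (F.card : ℂ) * ∑ δ' ∈ F, b δ') = ∑ δ ∈ F, star (a δ) * b δ := by
  rcases F.eq_empty_or_nonempty with rfl | hF
  · simp
  have hn : (F.card : ℂ) ≠ 0 := by exact_mod_cast hF.card_ne_zero
  have hstar : star (2 / (F.card : ℂ)) = 2 / (F.card : ℂ) := by simp
  simp only [star_sub, star_mul', hstar, star_sum]
  set A := ∑ δ ∈ F, star (a δ) with hA
  set B := ∑ δ ∈ F, b δ with hB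
  -- Summed over `F` with `n` elements, the correction terms add up to `(-2/n - 2/n + n(2/n)²)AB =
  -- 0`.
  have : ∀ δ, (star (a δ) - 2 / (F.card : ℂ) * A) * (b δ - 2 / (F.card : ℂ) * B)
      = star (a δ) * b δ - 2 / (F.card : ℂ) * B * star (a δ) - 2 / (F.card : ℂ) * A * b δ
        + (2 / (F.card : ℂ)) ^ 2 * A * B := fun δ => by ring
  simp only [this, Finset.sum_add_distrib, Finset.sum_sub_distrib, ← Finset.mul_sum, ← hA, ← hB,
    Finset.sum_const, nsmul_eq_mul]
  field_simp
  ring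

/-- The map is a permutation of coordinates followed by a reflection on each block of darts with a
common start. -/
theorem preservesForm_scattering [Fintype V] (s : D → V) (ρ : Equiv.Perm D) :
    PreservesForm (scattering s ρ) := by
  intro a b
  have h1 : star a ⬝ᵥ b = ∑ δ, star (a (ρ δ)) * b (ρ δ) :=
    (Equiv.sum_comp ρ fun δ => star (a δ) * b δ).symm
  rw [h1, ← Finset.sum_fiberwise _ s]
  change ∑ δ, star (scattering s ρ a δ) * scattering s ρ b δ = _
  rw [← Finset.sum_fiberwise _ s]
  refine Finset.sum_congr rfl fun v _ => ?_
  rw [← sum_star_mul_sub_two_average _ (fun δ => a (ρ δ)) fun δ => b (ρ δ)]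
  refine Finset.sum_congr rfl fun δ hδ => ?_
  rw [scattering_apply, scattering_apply, (Finset.mem_filter.1 hδ).2]

/-- The eigenvectors of the scattering endomorphism are the amplitudes for which the values sum up
to zero, and the derivatives agree, at every vertex. -/
theorem mem_eigenspace_scattering_iff (s : D → V) (ρ : Equiv.Perm D) {z : ℂ} (hz : z ≠ 0)
    (c : D → ℂ) : c ∈ (scattering s ρ).eigenspace z⁻¹ ↔
      (∀ v, ∑ δ with s δ = v, (c δ + z * c (ρ δ)) = 0) ∧
      ∀ δ δ', s δ = s δ' → z * c (ρ δ) - c δ = z * c (ρ δ') - c δ' := by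
  rw [End.mem_eigenspace_iff]
  constructor
  · intro h
    have h' : ∀ δ, z * c (ρ δ) - c δ = z * (2 / (Finset.card {δ' | s δ' = s δ} : ℂ)
        * ∑ δ' with s δ' = s δ, c (ρ δ')) := by
      intro δ
      have := congrFun h δ
      rw [scattering_apply, Pi.smul_apply, smul_eq_mul] at this
      field_simp at this ⊢
      linear_combination this
    refine ⟨fun v => ?_, fun δ δ' hs => by rw [h', h', hs]⟩
    set F : Finset D := {δ | s δ = v} with hF
    rcases F.eq_empty_or_nonempty with h0 | h0
    · rw [h0]; simp
    have hn : (F.card : ℂ) ≠ 0 := by exact_mod_cast h0.card_ne_zero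
    have : ∀ δ ∈ F, c δ + z * c (ρ δ)
        = 2 * z * c (ρ δ) - z * (2 / (F.card : ℂ) * ∑ δ' ∈ F, c (ρ δ')) := by
      intro δ hδ
      have := h' δ
      rw [(Finset.mem_filter.1 hδ).2, ← hF] at this
      linear_combination -this
    rw [Finset.sum_congr rfl this, Finset.sum_sub_distrib, ← Finset.mul_sum, Finset.sum_const,
      nsmul_eq_mul]
    field_simp
    ring
  · rintro ⟨h1, h2⟩
    funext δ
    rw [scattering_apply, Pi.smul_apply, smul_eq_mul]
    set F : Finset D := {δ' | s δ' = s δ} with hF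
    have hn : (F.card : ℂ) ≠ 0 := by
      have : F.Nonempty := ⟨δ, by simp [hF]⟩
      exact_mod_cast this.card_ne_zero
    -- The common value of `z c(ρδ') - c δ'` is found by summing over the vertex; adding the zero
    -- sum of values turns it into twice the average of `z c(ρδ')`.
    have h3 : ∑ δ' ∈ F, (z * c (ρ δ') - c δ') = F.card * (z * c (ρ δ) - c δ) := by
      rw [Finset.sum_congr rfl fun δ' hδ' => h2 δ' δ (Finset.mem_filter.1 hδ').2,
        Finset.sum_const, nsmul_eq_mul]
    have h4 : 2 * z * ∑ δ' ∈ F, c (ρ δ') = F.card * (z * c (ρ δ) - c δ) := by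
      rw [← h3, Finset.mul_sum, ← sub_eq_zero, ← h1 (s δ), ← Finset.sum_sub_distrib]
      exact Finset.sum_congr rfl fun _ _ => by ring
    field_simp
    linear_combination -h4

end Scattering

/-! ### Darts and the domain of the Laplacian -/

section Graph

variable {V : Type*} [Fintype V] [DecidableEq V] {Γ : SimpleGraph V} [DecidableRel Γ.Adj]

/-- The vertex at which a dart starts; the dart `(e, true)` runs through `e` from its head. -/
def Orientation.start (o : Orientation Γ) (δ : Γ.edgeSet × Bool) : V :=
  if δ.2 then o.head δ.1 else o.tail δ.1

/-- The reversal of darts. -/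
def dartFlip (Γ : SimpleGraph V) : Equiv.Perm (Γ.edgeSet × Bool) :=
  Equiv.prodCongr (Equiv.refl _) Equiv.boolNot

/-- The parameter of the start of a dart. -/
def endPoint (b : Bool) : unitInterval := if b then 1 else 0

/-- The sign of the outer normal derivative at the start of a dart. -/
def endSign (b : Bool) : ℂ := if b then 1 else -1

omit [Fintype V] [DecidableEq V] [DecidableRel Γ.Adj] in
theorem Orientation.head_ne_tail (o : Orientation Γ) (e : Γ.edgeSet) : o.head e ≠ o.tail e := by
  intro h
  have h1 : s(o.tail e, o.head e) ∈ Γ.edgeSet := by rw [o.edge_eq e]; exact e.2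
  rw [h, SimpleGraph.mem_edgeSet] at h1
  exact h1.ne rfl

omit [Fintype V] [DecidableEq V] [DecidableRel Γ.Adj] in
theorem Orientation.mem_iff (o : Orientation Γ) (v : V) (e : Γ.edgeSet) :
    v ∈ (e : Sym2 V) ↔ ∃ b, o.start (e, b) = v := by
  rw [← o.edge_eq e, Sym2.mem_iff, Bool.exists_bool]
  simp [Orientation.start, eq_comm]

omit [Fintype V] [DecidableRel Γ.Adj] in
theorem Orientation.d_start (o : Orientation Γ) (e : Γ.edgeSet) (b : Bool) :
    o.d (o.start (e, b)) e = endSign b := by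
  cases b
  · simp [Orientation.start, Orientation.d, endSign, o.head_ne_tail e]
  · simp [Orientation.start, Orientation.d, endSign]

omit [Fintype V] [DecidableRel Γ.Adj] in
theorem Orientation.pos_start (o : Orientation Γ) (e : Γ.edgeSet) (b : Bool) :
    o.pos (o.start (e, b)) e = endPoint b := by
  cases b
  · simp [Orientation.start, Orientation.pos, endPoint, o.head_ne_tail e]
  · simp [Orientation.start, Orientation.pos, endPoint]

theorem Orientation.sum_d_sq_mul (o : Orientation Γ) (u : EdgeFun Γ) (v : V) :
    ∑ e, o.d v e ^ 2 * u e (o.pos v e) = ∑ δ with o.start δ = v, u δ.1 (endPoint δ.2) := by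
  rw [Finset.sum_filter, Fintype.sum_prod_type]
  refine Finset.sum_congr rfl fun e _ => ?_
  rw [Fintype.sum_bool]
  have := o.head_ne_tail e
  by_cases h1 : o.head e = v
  · have h2 : o.tail e ≠ v := fun h => this (h1.trans h.symm)
    simp [Orientation.start, Orientation.d, Orientation.pos, endPoint, h1, h2]
  · by_cases h2 : o.tail e = v <;>
      simp [Orientation.start, Orientation.d, Orientation.pos, endPoint, h1, h2]

/-- Indexing by darts replaces the incidence matrix: a dart records both a vertex and an edge end,
so sums over edges at `v` become sums over a fibre of `o.start`. -/
theorem mem_kcDomain_iff (o : Orientation Γ) (u : EdgeFun Γ) :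
    u ∈ kcDomain o ↔ (∀ e, IsC2 (u e)) ∧
      (∀ v, ∑ δ with o.start δ = v, u δ.1 (endPoint δ.2) = 0) ∧
      ∀ δ δ', o.start δ = o.start δ' →
        endSign δ.2 * der (u δ.1) (endPoint δ.2) = endSign δ'.2 * der (u δ'.1) (endPoint δ'.2) := by
  change (_ ∧ _ ∧ _) ↔ _
  simp only [o.sum_d_sq_mul]
  refine and_congr_right fun _ => and_congr_right fun _ => ⟨fun h => ?_, fun h => ?_⟩
  · rintro ⟨e, b⟩ ⟨f, b'⟩ hs
    have := h (o.start (e, b)) e f ((o.mem_iff _ _).2 ⟨b, rfl⟩) ((o.mem_iff _ _).2 ⟨b', hs.symm⟩)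
    rw [o.d_start, o.pos_start] at this
    rwa [hs, o.d_start, o.pos_start] at this
  · intro v e f he hf
    obtain ⟨b, rfl⟩ := (o.mem_iff _ _).1 he
    obtain ⟨b', hb'⟩ := (o.mem_iff _ _).1 hf
    have := h (e, b) (f, b') hb'.symm
    rw [o.d_start, o.pos_start, ← hb', o.d_start, o.pos_start]
    exact this

theorem mem_eigenspace_negLaplacianKC_iff (o : Orientation Γ) (μ : ℂ) (u : EdgeFun Γ) :
    u ∈ eigenspace (negLaplacianKC o) μ ↔
      ∃ h : u ∈ kcDomain o, ∀ e x, -der2 (u e) (h.1 e) x = μ * u e x := by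
  rw [mem_eigenspace]
  refine exists_congr fun h => ⟨fun h' e x => ?_, fun h' => ?_⟩
  · exact DFunLike.congr_fun (congrFun h' e) x
  · funext e; ext x; exact h' e x

/-! ### Eigenfunctions for positive eigenvalues -/

/-- The superposition of waves with given outgoing amplitudes at the darts. -/
def waveMap (Γ : SimpleGraph V) [DecidableRel Γ.Adj] (κ : ℝ) :
    (Γ.edgeSet × Bool → ℂ) →ₗ[ℂ] EdgeFun Γ where
  toFun c e := wave κ (c (e, false)) (c (e, true))
  map_add' a b := by
    funext e; ext x
    simp only [Pi.add_apply, ContinuousMap.add_apply, wave_apply, waveLine]; ring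
  map_smul' r a := by
    funext e; ext x
    simp only [Pi.smul_apply, ContinuousMap.smul_apply, wave_apply, waveLine, smul_eq_mul,
      RingHom.id_apply]
    ring

omit [Fintype V] [DecidableEq V] in
theorem waveMap_apply (κ : ℝ) (c : Γ.edgeSet × Bool → ℂ) (e : Γ.edgeSet) :
    waveMap Γ κ c e = wave κ (c (e, false)) (c (e, true)) := rfl

omit [Fintype V] [DecidableEq V] in
theorem waveMap_injective {κ : ℝ} (hκ : κ ≠ 0) : Function.Injective (waveMap Γ κ) := by
  rw [← LinearMap.ker_eq_bot, LinearMap.ker_eq_bot']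
  intro c hc
  funext ⟨e, b⟩
  have h := wave_eq_zero hκ (congrFun hc e)
  cases b
  exacts [h.1, h.2]

omit [Fintype V] [DecidableEq V] in
theorem waveMap_endPoint (κ : ℝ) (c : Γ.edgeSet × Bool → ℂ) (δ : Γ.edgeSet × Bool) :
    waveMap Γ κ c δ.1 (endPoint δ.2)
      = c δ + Complex.exp (Complex.I * κ) * c (dartFlip Γ δ) := by
  obtain ⟨e, b⟩ := δ
  rw [waveMap_apply, wave_apply]
  cases b
  · simp [endPoint, waveLine_zero, dartFlip]; ring
  · simp [endPoint, waveLine_one, dartFlip]; ring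

omit [Fintype V] [DecidableEq V] in
theorem der_waveMap_endPoint (κ : ℝ) (c : Γ.edgeSet × Bool → ℂ) (δ : Γ.edgeSet × Bool) :
    endSign δ.2 * der (waveMap Γ κ c δ.1) (endPoint δ.2)
      = Complex.I * κ * (Complex.exp (Complex.I * κ) * c (dartFlip Γ δ) - c δ) := by
  obtain ⟨e, b⟩ := δ
  rw [waveMap_apply, der_wave]
  cases b
  · simp [endPoint, endSign, waveLine_zero, dartFlip]; ring
  · simp [endPoint, endSign, waveLine_one, dartFlip]; ring

/-- The differential equation puts an eigenfunction in the range of `waveMap`, and the vertex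
conditions on its amplitudes are the eigenvector equation for the scattering map. -/
theorem eigenspace_negLaplacianKC_sq (o : Orientation Γ) {κ : ℝ} (hκ : κ ≠ 0) :
    eigenspace (negLaplacianKC o) ((κ : ℂ) ^ 2)
      = ((scattering o.start (dartFlip Γ)).eigenspace
          (Complex.exp (-(Complex.I * κ)))).map (waveMap Γ κ) := by
  have hκ' : Complex.I * (κ : ℂ) ≠ 0 := mul_ne_zero Complex.I_ne_zero (by exact_mod_cast hκ)
  have key : ∀ c, waveMap Γ κ c ∈ kcDomain o ↔ c ∈ (scattering o.start (dartFlip Γ)).eigenspace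
      (Complex.exp (-(Complex.I * κ))) := by
    intro c
    rw [Complex.exp_neg, mem_eigenspace_scattering_iff _ _ (Complex.exp_ne_zero _),
      mem_kcDomain_iff]
    simp only [waveMap_endPoint, der_waveMap_endPoint, mul_right_inj' hκ']
    exact and_iff_right fun e => isC2_wave κ _ _
  ext u
  rw [mem_eigenspace_negLaplacianKC_iff, Submodule.mem_map]
  constructor
  · rintro ⟨h, hu⟩
    choose a b hab using fun e => exists_eq_wave (h.1 e) hκ (hu e)
    have e1 : waveMap Γ κ (fun δ => if δ.2 then b δ.1 else a δ.1) = u := by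
      funext e; rw [waveMap_apply, hab e]; rfl
    exact ⟨_, (key _).1 (e1 ▸ h), e1⟩
  · rintro ⟨c, hc, rfl⟩
    exact ⟨(key c).2 hc, fun e x => der2_wave κ _ _ x⟩

theorem geomMult_sq (o : Orientation Γ) {κ : ℝ} (hκ : κ ≠ 0) :
    geomMult (negLaplacianKC o) ((κ : ℂ) ^ 2)
      = (Module.finrank ℂ ((scattering o.start (dartFlip Γ)).eigenspace
          (Complex.exp (-(Complex.I * κ)))) : ℕ) := by
  rw [geomMult, eigenspace_negLaplacianKC_sq o hκ,
    ← (Submodule.equivMapOfInjective _ (waveMap_injective hκ) _).rank_eq, ← Module.finrank_eq_rank]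
  simp

/-! ### Green's formula -/

/-- The boundary terms in Green's formula cancel. -/
theorem sum_boundary_eq_zero (o : Orientation Γ) {u w : EdgeFun Γ} (hu : u ∈ kcDomain o)
    (hw : w ∈ kcDomain o) :
    ∑ e, star (lineExt (w e) 0) * lineDer (u e) 0 = ∑ e, star (lineExt (w e) 1) * lineDer (u e) 1 := by
  have h0 : ∀ f : C(unitInterval, ℂ), lineExt f 0 = f 0 := fun f =>
    lineExt_apply f (left_mem_Icc.2 zero_le_one)
  have h1 : ∀ f : C(unitInterval, ℂ), lineExt f 1 = f 1 := fun f =>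
    lineExt_apply f (right_mem_Icc.2 zero_le_one)
  have key : ∑ δ : Γ.edgeSet × Bool, star (w δ.1 (endPoint δ.2))
      * (endSign δ.2 * der (u δ.1) (endPoint δ.2)) = 0 := by
    rw [← Finset.sum_fiberwise _ o.start]
    refine Finset.sum_eq_zero fun v _ => ?_
    obtain ⟨-, -, hu2⟩ := (mem_kcDomain_iff o u).1 hu
    obtain ⟨-, hw1, -⟩ := (mem_kcDomain_iff o w).1 hw
    rcases Finset.eq_empty_or_nonempty ({δ | o.start δ = v} : Finset (Γ.edgeSet × Bool))
      with h | ⟨δ₀, hδ₀⟩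
    · rw [h, Finset.sum_empty]
    -- The outer derivative of `u` is the same along all darts at `v`, so it factors out and leaves
    -- the conjugate of the vanishing sum of the values of `w`.
    · rw [Finset.sum_congr rfl fun δ hδ => by
        rw [hu2 δ δ₀ ((Finset.mem_filter.1 hδ).2.trans (Finset.mem_filter.1 hδ₀).2.symm)],
        ← Finset.sum_mul, ← star_sum, hw1 v, star_zero, zero_mul]
  rw [Fintype.sum_prod_type] at key
  rw [eq_comm, ← sub_eq_zero, ← key, ← Finset.sum_sub_distrib]
  refine Finset.sum_congr rfl fun e _ => ?_
  rw [Fintype.sum_bool, h0, h1]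
  simp [endPoint, endSign, der_eq_lineDer]
  ring

theorem ofReal_normSq (z : ℂ) : (Complex.normSq z : ℂ) = star z * z :=
  Complex.normSq_eq_conj_mul_self

/-- The energy identity for eigenfunctions, multiplied by a suitable complex number. -/
theorem energy_eq_zero (o : Orientation Γ) {μ α : ℂ} (hα : 0 ≤ α.re) (hαμ : (α * μ).re ≤ 0)
    {u : EdgeFun Γ} (hu : u ∈ eigenspace (negLaplacianKC o) μ) {x : ℝ} (hx : x ∈ Icc (0 : ℝ) 1) :
    α.re * ∑ e, Complex.normSq (lineDer (u e) x)
      + -(α * μ).re * ∑ e, Complex.normSq (lineExt (u e) x) = 0 := by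
  obtain ⟨h, hu⟩ := (mem_eigenspace_negLaplacianKC_iff o μ u).1 hu
  -- By `u'' = -μu`, the function `Re(α ∑ ū u')` has derivative `Re α ∑ |u'|² - Re(αμ) ∑ |u|²`, and
  -- both terms are nonnegative.
  refine deriv_eq_zero_of_nonneg_of_endpoints_eq
    (G := fun x => (α * ∑ e, star (lineExt (u e) x) * lineDer (u e) x).re)
    (g := fun x => α.re * ∑ e, Complex.normSq (lineDer (u e) x)
      + -(α * μ).re * ∑ e, Complex.normSq (lineExt (u e) x)) (fun y hy => ?_) (fun y hy => ?_)
    (by simp only [sum_boundary_eq_zero o h h]) x hx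
  · have h1 : HasDerivWithinAt (fun x => α * ∑ e, star (lineExt (u e) x) * lineDer (u e) x)
        (α * ∑ e, (star (lineDer (u e) y) * lineDer (u e) y
          + star (lineExt (u e) y) * der2 (u e) (h.1 e) ⟨y, hy⟩)) (Icc 0 1) y :=
      (HasDerivWithinAt.fun_sum fun e _ => ((h.1 e).hasDerivWithinAt hy).star.mul
        ((h.1 e).hasDerivWithinAt_lineDer hy)).const_mul α
    have h2 := (Complex.reCLM.hasFDerivAt.comp_hasDerivWithinAt y h1)
    refine h2.congr_deriv ?_
    have h3 : α * ∑ e, (star (lineDer (u e) y) * lineDer (u e) y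
          + star (lineExt (u e) y) * der2 (u e) (h.1 e) ⟨y, hy⟩)
        = α * ((∑ e, Complex.normSq (lineDer (u e) y) : ℝ) : ℂ)
          - (α * μ) * ((∑ e, Complex.normSq (lineExt (u e) y) : ℝ) : ℂ) := by
      push_cast
      rw [mul_assoc, ← mul_sub, Finset.mul_sum _ _ μ, ← Finset.sum_sub_distrib]
      congr 1
      refine Finset.sum_congr rfl fun e _ => ?_
      have := hu e ⟨y, hy⟩
      rw [← lineExt_apply (u e) hy] at this
      rw [ofReal_normSq, ofReal_normSq]
      linear_combination -star (lineExt (u e) y) * this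
    rw [h3]
    simp only [Complex.reCLM_apply, Complex.sub_re, Complex.re_mul_ofReal]
    ring
  · exact add_nonneg (mul_nonneg hα (Finset.sum_nonneg fun _ _ => Complex.normSq_nonneg _))
      (mul_nonneg (neg_nonneg.2 hαμ) (Finset.sum_nonneg fun _ _ => Complex.normSq_nonneg _))

omit [DecidableEq V] in
theorem edgeFun_eq_zero {u : EdgeFun Γ}
    (h : ∀ x ∈ Icc (0 : ℝ) 1, ∑ e, Complex.normSq (lineExt (u e) x) = 0) : u = 0 := by
  funext e; ext x
  have := (Finset.sum_eq_zero_iff_of_nonneg fun _ _ => Complex.normSq_nonneg _).1 (h x x.2) e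
    (Finset.mem_univ e)
  rw [Complex.normSq_eq_zero, lineExt_apply _ x.2] at this
  exact this

theorem eigenspace_eq_bot_of_re_neg (o : Orientation Γ) {μ α : ℂ} (hα : 0 ≤ α.re)
    (hαμ : (α * μ).re < 0) : eigenspace (negLaplacianKC o) μ = ⊥ := by
  rw [Submodule.eq_bot_iff]
  intro u hu
  refine edgeFun_eq_zero fun x hx => ?_
  have h := energy_eq_zero o hα hαμ.le hu hx
  have h1 : 0 ≤ α.re * ∑ e, Complex.normSq (lineDer (u e) x) :=
    mul_nonneg hα (Finset.sum_nonneg fun _ _ => Complex.normSq_nonneg _)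
  have h2 : 0 ≤ ∑ e, Complex.normSq (lineExt (u e) x) :=
    Finset.sum_nonneg fun _ _ => Complex.normSq_nonneg _
  have h3 := mul_nonneg (neg_nonneg.2 hαμ.le) h2
  have h4 : -(α * μ).re * ∑ e, Complex.normSq (lineExt (u e) x) = 0 := by linarith
  exact (mul_eq_zero.1 h4).resolve_left (by linarith)

/-- All eigenvalues are nonnegative real numbers. -/
theorem eigenspace_eq_bot_of_not_nonneg (o : Orientation Γ) {μ : ℂ}
    (hμ : ¬∃ r : ℝ, 0 ≤ r ∧ μ = r) : eigenspace (negLaplacianKC o) μ = ⊥ := by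
  -- The multipliers `∓i` turn `Re(αμ)` into `±Im μ`; `α = 1` handles negative real `μ`.
  rcases lt_trichotomy μ.im 0 with h | h | h
  · exact eigenspace_eq_bot_of_re_neg o (α := -Complex.I) (by simp) (by simpa using h)
  · have hr : μ = (μ.re : ℂ) := Complex.ext rfl (by simpa using h)
    refine eigenspace_eq_bot_of_re_neg o (α := 1) (by simp) ?_
    rw [one_mul]
    by_contra h'
    exact hμ ⟨μ.re, not_lt.1 h', hr⟩
  · exact eigenspace_eq_bot_of_re_neg o (α := Complex.I) (by simp) (by simpa using h)

/-- Eigenfunctions for the eigenvalue `0` are constant on each edge. -/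
theorem geomMult_zero_ne_top (o : Orientation Γ) : geomMult (negLaplacianKC o) 0 ≠ ⊤ := by
  let ev : EdgeFun Γ →ₗ[ℂ] (Γ.edgeSet → ℂ) :=
    { toFun := fun u e => u e 0
      map_add' := fun _ _ => rfl
      map_smul' := fun _ _ => rfl }
  have hinj : Function.Injective (ev.comp (eigenspace (negLaplacianKC o) 0).subtype) := by
    refine (injective_iff_map_eq_zero _).2 ?_
    rintro ⟨u, hu⟩ h0
    have hdom := ((mem_eigenspace_negLaplacianKC_iff o 0 u).1 hu).1
    -- For `μ = 0` and `α = 1` the energy identity contains only the derivatives.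
    have hder : ∀ e, ∀ x ∈ Icc (0 : ℝ) 1, lineDer (u e) x = 0 := by
      intro e x hx
      have := energy_eq_zero o (α := 1) (by simp) (by simp) hu hx
      simp only [Complex.one_re, one_mul, Complex.zero_re, neg_zero, zero_mul, add_zero] at this
      exact Complex.normSq_eq_zero.1 ((Finset.sum_eq_zero_iff_of_nonneg
        fun _ _ => Complex.normSq_nonneg _).1 this e (Finset.mem_univ e))
    have : u = 0 := by
      funext e; ext x
      have h1 := eq_left_of_hasDerivWithinAt_zero (F := lineExt (u e))
        (fun y hy => hder e y hy ▸ (hdom.1 e).hasDerivWithinAt hy) x x.2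
      rw [lineExt_apply _ x.2, lineExt_apply _ (left_mem_Icc.2 zero_le_one)] at h1
      exact h1.trans (congrFun h0 e)
    exact Subtype.ext this
  have : Module.Finite ℂ (eigenspace (negLaplacianKC o) 0) := Module.Finite.of_injective _ hinj
  simpa [geomMult] using Module.rank_lt_aleph0 ℂ (eigenspace (negLaplacianKC o) 0)

/-- There are no proper generalized eigenfunctions. -/
theorem eq_zero_of_mem_eigenspace_of_sub_eq (o : Orientation Γ) {μ : ℂ} {u w : EdgeFun Γ}
    (hu : u ∈ kcDomain o) (hw : w ∈ eigenspace (negLaplacianKC o) μ)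
    (huw : ∀ e x, -der2 (u e) (hu.1 e) x - μ * u e x = w e x) : w = 0 := by
  by_cases hμ : ∃ r : ℝ, 0 ≤ r ∧ μ = r
  swap
  · rw [eigenspace_eq_bot_of_not_nonneg o hμ] at hw; exact hw
  obtain ⟨r, -, rfl⟩ := hμ
  obtain ⟨h, hw⟩ := (mem_eigenspace_negLaplacianKC_iff o _ w).1 hw
  refine edgeFun_eq_zero fun x hx => ?_
  -- Since `μ = r` is real, the Wronskian-type sum of `w̄' u - w̄ u'` has derivative `∑ |w|²`, and
  -- its end values agree by Green's formula used in both orders.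
  refine deriv_eq_zero_of_nonneg_of_endpoints_eq
    (G := fun x => (∑ e, (star (lineDer (w e) x) * lineExt (u e) x
      - star (lineExt (w e) x) * lineDer (u e) x)).re)
    (g := fun x => ∑ e, Complex.normSq (lineExt (w e) x)) (fun y hy => ?_)
    (fun _ _ => Finset.sum_nonneg fun _ _ => Complex.normSq_nonneg _) ?_ x hx
  · have h1 : HasDerivWithinAt (fun x => ∑ e, (star (lineDer (w e) x) * lineExt (u e) x
        - star (lineExt (w e) x) * lineDer (u e) x))
        (∑ e, ((star (der2 (w e) (h.1 e) ⟨y, hy⟩) * lineExt (u e) y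
          + star (lineDer (w e) y) * lineDer (u e) y)
          - (star (lineDer (w e) y) * lineDer (u e) y
          + star (lineExt (w e) y) * der2 (u e) (hu.1 e) ⟨y, hy⟩))) (Icc 0 1) y :=
      HasDerivWithinAt.fun_sum fun e _ =>
        (((h.1 e).hasDerivWithinAt_lineDer hy).star.mul ((hu.1 e).hasDerivWithinAt hy)).sub
        (((h.1 e).hasDerivWithinAt hy).star.mul ((hu.1 e).hasDerivWithinAt_lineDer hy))
    refine (Complex.reCLM.hasFDerivAt.comp_hasDerivWithinAt y h1).congr_deriv ?_
    rw [Complex.reCLM_apply, Complex.re_sum]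
    refine Finset.sum_congr rfl fun e _ => ?_
    have h2 := huw e ⟨y, hy⟩
    have h3 := congrArg star (hw e ⟨y, hy⟩)
    rw [star_neg, star_mul'] at h3
    have h4 : star (r : ℂ) = r := Complex.conj_ofReal r
    rw [h4] at h3
    rw [← lineExt_apply (w e) hy] at h2 h3
    rw [← lineExt_apply (u e) hy] at h2
    rw [← Complex.ofReal_re (Complex.normSq (lineExt (w e) y)), ofReal_normSq]
    congr 1
    linear_combination star (lineExt (w e) y) * h2 - lineExt (u e) y * h3
  · have h1 := sum_boundary_eq_zero o hu h
    have h2 := congrArg star (sum_boundary_eq_zero o h hu)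
    simp only [star_sum, star_mul, star_star] at h2
    simp only [Finset.sum_sub_distrib]
    rw [h1, h2]

theorem geomMult_eq_algMult (o : Orientation Γ) (μ : ℂ) :
    geomMult (negLaplacianKC o) μ = algMult (negLaplacianKC o) μ := by
  have key : ∀ k, genEigenspace (negLaplacianKC o) μ k ≤ eigenspace (negLaplacianKC o) μ := by
    intro k
    induction k with
    | zero => exact bot_le
    | succ k ih =>
      rintro u ⟨⟨u, hu⟩, h, rfl⟩
      have h1 : negLaplacianKC o ⟨u, hu⟩ - μ • u ∈ eigenspace (negLaplacianKC o) μ := ih h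
      have h2 := eq_zero_of_mem_eigenspace_of_sub_eq o hu h1 fun _ _ => rfl
      exact mem_eigenspace.2 ⟨hu, sub_eq_zero.1 h2⟩
  have : (⨆ k, genEigenspace (negLaplacianKC o) μ k) = eigenspace (negLaplacianKC o) μ :=
    le_antisymm (iSup_le key) (le_iSup (genEigenspace (negLaplacianKC o) μ) 1)
  rw [geomMult, algMult, this]

end Graph

/-! ### Monotone sequences with prescribed multiplicities -/

section Sequences

/-- A monotone sequence with finite sublevel sets is determined by the multiplicities of its
values. -/
theorem eq_of_monotone_of_encard_fiber_eq {a b : ℕ → ℝ} (ha : Monotone a) (hb : Monotone b)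
    (hfin : ∀ x, {k | a k < x}.Finite)
    (h : ∀ x, {k | b k = x}.encard = {k | a k = x}.encard) : b = a := by
  have hfa : ∀ x, {k | a k = x}.Finite := fun x =>
    (hfin (x + 1)).subset fun k (hk : a k = x) => by simp [hk]
  have hfb : ∀ x, {k | b k = x}.Finite := fun x => by
    rw [← encard_ne_top_iff, h, encard_ne_top_iff]; exact hfa x
  -- Matching fibres of equal finite size gives a permutation `σ` with `b ∘ σ = a`, so both
  -- sequences have equally many terms below any bound.
  have hequiv : ∀ x, Nonempty ({k // a k = x} ≃ {k // b k = x}) := fun x => by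
    have : Finite {k // a k = x} := (hfa x).to_subtype
    have : Finite {k // b k = x} := (hfb x).to_subtype
    exact Finite.card_eq.1 (congrArg ENat.toNat (h x)).symm
  set σ : ℕ ≃ ℕ := Equiv.ofFiberEquiv fun x => (hequiv x).some with hσ
  have hbσ : ∀ k, b (σ k) = a k := fun k => Equiv.ofFiberEquiv_map _ k
  have himage : ∀ x, {k | b k < x} = σ '' {k | a k < x} := by
    intro x
    ext k
    obtain ⟨i, rfl⟩ := σ.surjective k
    simp [hbσ]
  have hcard : ∀ x, {k | b k < x}.ncard = {k | a k < x}.ncard := fun x => by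
    rw [himage, ncard_image_of_injective _ σ.injective]
  have hfinb : ∀ x, {k | b k < x}.Finite := fun x => by
    rw [himage]; exact (hfin x).image _
  -- If `c k < d k`, then at least `k + 1` terms of `c` but at most `k` terms of `d` lie below `d
  -- k`.
  have key : ∀ {c d : ℕ → ℝ}, Monotone c → Monotone d → (∀ x, {k | c k < x}.Finite) →
      (∀ x, {k | d k < x}.ncard = {k | c k < x}.ncard) → ∀ k, d k ≤ c k := by
    intro c d hc hd hf hcd k
    by_contra hlt
    push Not at hlt
    have h1 : Iic k ⊆ {i | c i < d k} := fun i hi => (hc hi).trans_lt hlt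
    have h2 : {i | d i < d k} ⊆ Iio k := fun i hi => by
      by_contra hik
      exact absurd (hd (not_lt.1 hik)) (not_le.2 hi)
    have h3 := ncard_le_ncard h1 (hf _)
    have h4 := ncard_le_ncard h2 (finite_Iio k)
    rw [← hcd] at h3
    simp at h3 h4
    omega
  funext k
  exact le_antisymm (key ha hb hfin hcard k) (key hb ha hfinb (fun x => (hcard x).symm) k)

variable {n : ℕ}

/-- The `2π`-periodic continuation of a finite sequence of angles. -/
def frequency (hn : 0 < n) (θ : Fin n → ℝ) (i : ℕ) : ℝ :=
  θ ⟨i % n, Nat.mod_lt i hn⟩ + 2 * Real.pi * (i / n : ℕ)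

theorem frequency_mul_add (hn : 0 < n) (θ : Fin n → ℝ) (q : ℕ) (j : Fin n) :
    frequency hn θ (n * q + j) = θ j + 2 * Real.pi * q := by
  have h1 : (n * q + j) % n = j := by rw [Nat.mul_add_mod, Nat.mod_eq_of_lt j.2]
  have h2 : (n * q + j) / n = q := by
    rw [Nat.mul_add_div hn, Nat.div_eq_of_lt j.2, add_zero]
  simp only [frequency, h1, h2]

theorem exists_eq_mul_add (hn : 0 < n) (i : ℕ) : ∃ (q : ℕ) (j : Fin n), i = n * q + j :=
  ⟨i / n, ⟨i % n, Nat.mod_lt i hn⟩, (Nat.div_add_mod i n).symm⟩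

theorem frequency_pos (hn : 0 < n) {θ : Fin n → ℝ} (hθ : ∀ j, θ j ∈ Ioc 0 (2 * Real.pi)) (i : ℕ) :
    0 < frequency hn θ i :=
  add_pos_of_pos_of_nonneg (hθ _).1 (by positivity)

/-- Successive blocks of length `n` do not overlap: block `q` lies in `(2πq, 2π(q+1)]`. -/
theorem monotone_frequency (hn : 0 < n) {θ : Fin n → ℝ} (hmono : Monotone θ)
    (hθ : ∀ j, θ j ∈ Ioc 0 (2 * Real.pi)) : Monotone (frequency hn θ) := by
  intro a b hab
  obtain ⟨q, j, rfl⟩ := exists_eq_mul_add hn a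
  obtain ⟨r, l, rfl⟩ := exists_eq_mul_add hn b
  rw [frequency_mul_add, frequency_mul_add]
  rcases lt_trichotomy q r with h | rfl | h
  · have h1 : (q : ℝ) + 1 ≤ r := by exact_mod_cast h
    nlinarith [(hθ j).2, (hθ l).1, Real.pi_pos]
  · have : j ≤ l := by
      rw [Fin.le_def]; omega
    linarith [hmono this]
  · have h1 : n * (r + 1) ≤ n * q := Nat.mul_le_mul_left n h
    have := l.2
    rw [mul_add] at h1
    omega

theorem abs_frequency_sub_le (hn : 0 < n) {θ : Fin n → ℝ} (hθ : ∀ j, θ j ∈ Ioc 0 (2 * Real.pi))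
    (i : ℕ) : |frequency hn θ i - 2 * Real.pi / n * i| ≤ 2 * Real.pi := by
  obtain ⟨q, j, rfl⟩ := exists_eq_mul_add hn i
  have hn' : (0 : ℝ) < n := by exact_mod_cast hn
  have h1 : frequency hn θ (n * q + j) - 2 * Real.pi / n * ((n * q + j : ℕ) : ℝ)
      = θ j - 2 * Real.pi * (j / n) := by
    rw [frequency_mul_add]; push_cast; field_simp; ring
  have h2 : (j : ℝ) / n ≤ 1 := by
    rw [div_le_one hn']; exact_mod_cast j.2.le
  have h3 : 0 ≤ (j : ℝ) / n := by positivity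
  rw [h1, abs_le]
  constructor <;> nlinarith [(hθ j).1, (hθ j).2, Real.pi_pos]

theorem encard_frequency_eq (hn : 0 < n) {θ : Fin n → ℝ} (hθ : ∀ j, θ j ∈ Ioc 0 (2 * Real.pi))
    {t : ℝ} (ht : t ∈ Ioc 0 (2 * Real.pi)) (q : ℕ) :
    {i | frequency hn θ i = t + 2 * Real.pi * q}.encard = ({j | θ j = t}.ncard : ℕ) := by
  have himage : {i | frequency hn θ i = t + 2 * Real.pi * q}
      = (fun j : Fin n => n * q + (j : ℕ)) '' {j | θ j = t} := by
    ext i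
    constructor
    · obtain ⟨r, j, rfl⟩ := exists_eq_mul_add hn i
      intro h
      rw [mem_ofPred_eq, frequency_mul_add] at h
      have hpi := Real.two_pi_pos
      -- Two angles in `(0, 2π]` differ by less than `2π`, which forces the same block.
      have h1 : (q : ℝ) < r + 1 := by
        by_contra h'; push Not at h'; nlinarith [(hθ j).2, ht.1]
      have h2 : (r : ℝ) < q + 1 := by
        by_contra h'; push Not at h'; nlinarith [(hθ j).1, ht.2]
      have h3 : r = q := by
        have h1' : q < r + 1 := by exact_mod_cast h1
        have h2' : r < q + 1 := by exact_mod_cast h2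
        omega
      subst h3
      exact ⟨j, add_right_cancel h, rfl⟩
    · rintro ⟨j, hj, rfl⟩
      rw [mem_ofPred_eq, frequency_mul_add, hj]
  have hinj : Function.Injective fun j : Fin n => n * q + (j : ℕ) := fun j l h =>
    Fin.ext (Nat.add_left_cancel h)
  rw [himage, hinj.encard_image, (toFinite _).cast_ncard_eq]

/-- The sequence that starts with `m` zeros and goes on with the squares of the frequencies. -/
def eigenvalueSeq (m : ℕ) (hn : 0 < n) (θ : Fin n → ℝ) (k : ℕ) : ℝ :=
  if k < m then 0 else frequency hn θ (k - m) ^ 2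

theorem monotone_eigenvalueSeq (m : ℕ) (hn : 0 < n) {θ : Fin n → ℝ} (hmono : Monotone θ)
    (hθ : ∀ j, θ j ∈ Ioc 0 (2 * Real.pi)) : Monotone (eigenvalueSeq m hn θ) := by
  intro a b hab
  unfold eigenvalueSeq
  split_ifs with h1 h2
  · exact le_rfl
  · positivity
  · omega
  · exact pow_le_pow_left₀ (frequency_pos hn hθ _).le
      (monotone_frequency hn hmono hθ (by omega)) 2

theorem setOf_eigenvalueSeq_eq_zero (m : ℕ) (hn : 0 < n) {θ : Fin n → ℝ}
    (hθ : ∀ j, θ j ∈ Ioc 0 (2 * Real.pi)) : {k | eigenvalueSeq m hn θ k = 0} = Iio m := by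
  ext k
  have := (frequency_pos hn hθ (k - m)).ne'
  simp [eigenvalueSeq, this]

theorem setOf_eigenvalueSeq_eq_sq (m : ℕ) (hn : 0 < n) {θ : Fin n → ℝ}
    (hθ : ∀ j, θ j ∈ Ioc 0 (2 * Real.pi)) {κ : ℝ} (hκ : 0 < κ) :
    {k | eigenvalueSeq m hn θ k = κ ^ 2} = (fun i => m + i) '' {i | frequency hn θ i = κ} := by
  ext k
  rcases lt_or_ge k m with h | h
  · refine iff_of_false ?_ ?_
    · simp [eigenvalueSeq, h, (pow_pos hκ 2).ne]
    · rintro ⟨i, -, rfl⟩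
      exact absurd h (not_lt.2 (Nat.le_add_right m i))
  · obtain ⟨i, rfl⟩ := Nat.exists_eq_add_of_le h
    simp [eigenvalueSeq, pow_left_inj₀ (frequency_pos hn hθ i).le hκ.le]

theorem tendsto_eigenvalueSeq_div (m : ℕ) (hn : 0 < n) {θ : Fin n → ℝ}
    (hθ : ∀ j, θ j ∈ Ioc 0 (2 * Real.pi)) :
    Filter.Tendsto (fun k : ℕ => eigenvalueSeq m hn θ k / ((k : ℝ) + 1) ^ 2) Filter.atTop
      (nhds ((2 * Real.pi / n) ^ 2)) := by
  have h1 : Filter.Tendsto (fun k : ℕ => frequency hn θ (k - m) / ((k : ℝ) + 1)) Filter.atTop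
      (nhds (2 * Real.pi / n)) := by
    rw [tendsto_iff_norm_sub_tendsto_zero]
    -- The first summand bounds the deviation of a frequency from linear growth; the second pays for
    -- the `m` zeros and for the index shift from `k` to `k + 1`.
    set C : ℝ := 2 * Real.pi + 2 * Real.pi / n * (m + 1) with hC
    have hlim : Filter.Tendsto (fun k : ℕ => C * (1 / ((k : ℝ) + 1))) Filter.atTop (nhds 0) := by
      simpa using (tendsto_one_div_add_atTop_nhds_zero_nat (𝕜 := ℝ)).const_mul C
    refine tendsto_of_tendsto_of_tendsto_of_le_of_le' tendsto_const_nhds hlim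
      (Filter.Eventually.of_forall fun _ => norm_nonneg _) ?_
    filter_upwards [Filter.eventually_ge_atTop m] with k hk
    obtain ⟨i, rfl⟩ := Nat.exists_eq_add_of_le hk
    have hpos : (0 : ℝ) < ((m + i : ℕ) : ℝ) + 1 := by positivity
    have h2 : frequency hn θ (m + i - m) / (((m + i : ℕ) : ℝ) + 1) - 2 * Real.pi / n
        = ((frequency hn θ i - 2 * Real.pi / n * i) - 2 * Real.pi / n * (m + 1))
          * (1 / (((m + i : ℕ) : ℝ) + 1)) := by
      rw [Nat.add_sub_cancel_left]
      field_simp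
      push_cast
      ring
    rw [h2, norm_mul, Real.norm_of_nonneg (one_div_pos.2 hpos).le]
    refine mul_le_mul_of_nonneg_right ?_ (one_div_pos.2 hpos).le
    refine (norm_sub_le _ _).trans (add_le_add (abs_frequency_sub_le hn hθ i) ?_)
    rw [Real.norm_of_nonneg (by positivity)]
  refine (h1.pow 2).congr' ?_
  filter_upwards [Filter.eventually_ge_atTop m] with k hk
  rw [eigenvalueSeq, if_neg (not_lt.2 hk), div_pow]

theorem finite_setOf_eigenvalueSeq_lt (m : ℕ) (hn : 0 < n) {θ : Fin n → ℝ}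
    (hθ : ∀ j, θ j ∈ Ioc 0 (2 * Real.pi)) (x : ℝ) : {k | eigenvalueSeq m hn θ k < x}.Finite := by
  have hn' : (0 : ℝ) < n := by exact_mod_cast hn
  have hlim : Filter.Tendsto (eigenvalueSeq m hn θ) Filter.atTop Filter.atTop := by
    have h1 : Filter.Tendsto (fun k : ℕ => ((k : ℝ) + 1) ^ 2) Filter.atTop Filter.atTop :=
      (Filter.tendsto_pow_atTop two_ne_zero).comp
        (Filter.tendsto_atTop_add_const_right _ 1 tendsto_natCast_atTop_atTop)
    refine ((tendsto_eigenvalueSeq_div m hn hθ).pos_mul_atTop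
      (pow_pos (div_pos Real.two_pi_pos hn') 2) h1).congr fun k => ?_
    rw [div_mul_cancel₀ _ (by positivity)]
  have := hlim.eventually_ge_atTop x
  rw [← Nat.cofinite_eq_atTop, Filter.eventually_cofinite] at this
  simpa using this

end Sequences

/-! ### Assembly of the spectrum -/

section Spectrum

variable {V : Type*} [Fintype V] [DecidableEq V] {Γ : SimpleGraph V} [DecidableRel Γ.Adj]

theorem exists_angle_add_two_pi_mul {κ : ℝ} (hκ : 0 < κ) :
    ∃ t ∈ Ioc 0 (2 * Real.pi), ∃ q : ℕ, κ = t + 2 * Real.pi * q := by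
  have hpi := Real.two_pi_pos
  have ht : toIocMod hpi 0 κ ∈ Ioc 0 (2 * Real.pi) := by simpa using toIocMod_mem_Ioc hpi 0 κ
  have h := toIocMod_add_toIocDiv_zsmul hpi 0 κ
  rw [zsmul_eq_mul] at h
  -- A negative quotient would give `κ ≤ 2π - 2π = 0`.
  have hq : 0 ≤ toIocDiv hpi 0 κ := by
    by_contra hneg
    push Not at hneg
    have : ((toIocDiv hpi 0 κ : ℤ) : ℝ) ≤ -1 := by exact_mod_cast Int.le_sub_one_of_lt hneg
    nlinarith [ht.2]
  obtain ⟨q, hq⟩ := Int.eq_ofNat_of_zero_le hq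
  refine ⟨_, ht, q, ?_⟩
  rw [hq] at h
  push_cast at h
  linarith

/-- The spectrum consists of an eigenvalue `0` of finite multiplicity and the squares of finitely
many arithmetic progressions with difference `2π`. -/
theorem exists_isEigenvalueSequence (o : Orientation Γ) {n : ℕ} (hn : 0 < n)
    (hcard : Fintype.card (Γ.edgeSet × Bool) = n) :
    ∃ (m : ℕ) (θ : Fin n → ℝ), Monotone θ ∧ (∀ j, θ j ∈ Ioc 0 (2 * Real.pi)) ∧
      IsEigenvalueSequence (negLaplacianKC o) (eigenvalueSeq m hn θ) := by
  subst hcard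
  obtain ⟨θ, hmono, hθ, hcount⟩ :=
    (preservesForm_scattering o.start (dartFlip Γ)).exists_angles
  obtain ⟨m, hm⟩ := ENat.ne_top_iff_exists.1 (geomMult_zero_ne_top o)
  refine ⟨m, θ, hmono, hθ, monotone_eigenvalueSeq m hn hmono hθ, fun μ => ?_⟩
  by_cases hμ : ∃ r : ℝ, 0 ≤ r ∧ μ = r
  · obtain ⟨r, hr, rfl⟩ := hμ
    simp only [Complex.ofReal_inj]
    rcases hr.eq_or_lt with rfl | hr
    · rw [setOf_eigenvalueSeq_eq_zero m hn hθ, Complex.ofReal_zero, ← hm,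
        ← Finset.coe_Iio, encard_coe_eq_coe_finsetCard, Nat.card_Iio]
    · obtain ⟨κ, hκ, rfl⟩ : ∃ κ : ℝ, 0 < κ ∧ r = κ ^ 2 :=
        ⟨√r, Real.sqrt_pos.2 hr, (Real.sq_sqrt hr.le).symm⟩
      rw [setOf_eigenvalueSeq_eq_sq m hn hθ hκ, (add_right_injective m).encard_image,
        Complex.ofReal_pow, geomMult_sq o hκ.ne']
      obtain ⟨t, ht, q, rfl⟩ := exists_angle_add_two_pi_mul hκ
      rw [encard_frequency_eq hn hθ ht, hcount t ht]
      have hexp : Complex.exp (-(Complex.I * t))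
          = Complex.exp (-(Complex.I * (t + 2 * Real.pi * q : ℝ))) := by
        rw [Complex.exp_eq_exp_iff_exists_int]
        refine ⟨q, ?_⟩
        push_cast
        ring
      rw [hexp]
  · have h0 : geomMult (negLaplacianKC o) μ = 0 := by
      rw [geomMult, eigenspace_eq_bot_of_not_nonneg o hμ]; simp
    rw [h0, encard_eq_zero, eq_empty_iff_forall_notMem]
    rintro k rfl
    refine hμ ⟨_, ?_, rfl⟩
    unfold eigenvalueSeq
    split_ifs
    · exact le_rfl
    · positivity

end Spectrum

end KCGraph

end

theorem corollary4p3 {V : Type*} [Fintype V] [DecidableEq V] (Γ : SimpleGraph V)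
    [DecidableRel Γ.Adj] (o : KCGraph.Orientation Γ) (hN : 0 < Γ.edgeFinset.card) :
    (∀ μ : ℂ, KCGraph.geomMult (KCGraph.negLaplacianKC o) μ
      = KCGraph.algMult (KCGraph.negLaplacianKC o) μ) ∧
    (∃ lam : ℕ → ℝ, KCGraph.IsEigenvalueSequence (KCGraph.negLaplacianKC o) lam) ∧
    (∀ lam : ℕ → ℝ, KCGraph.IsEigenvalueSequence (KCGraph.negLaplacianKC o) lam →
      Filter.Tendsto (fun k : ℕ => lam k / ((k : ℝ) + 1) ^ 2) Filter.atTop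
        (nhds (Real.pi ^ 2 / (Γ.edgeFinset.card : ℝ) ^ 2))) := by
  have hcard : Fintype.card (Γ.edgeSet × Bool) = 2 * Γ.edgeFinset.card := by
    rw [Fintype.card_prod, Fintype.card_bool, SimpleGraph.edgeFinset, Set.toFinset_card, mul_comm]
  obtain ⟨m, θ, hmono, hθ, hseq⟩ :=
    KCGraph.exists_isEigenvalueSequence o (Nat.mul_pos two_pos hN) hcard
  refine ⟨KCGraph.geomMult_eq_algMult o, ⟨_, hseq⟩, fun lam hlam => ?_⟩
  -- The multiplicities determine the sequence, so the limit need only be computed for the explicit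
  -- one.
  have heq : lam = KCGraph.eigenvalueSeq m (Nat.mul_pos two_pos hN) θ := by
    refine KCGraph.eq_of_monotone_of_encard_fiber_eq hseq.monotone hlam.monotone
      (KCGraph.finite_setOf_eigenvalueSeq_lt m _ hθ) fun x => ?_
    have h1 := hlam.encard_eq x
    have h2 := hseq.encard_eq x
    simp only [Complex.ofReal_inj] at h1 h2
    rw [h1, h2]
  rw [heq]
  -- With `n = 2N` darts, `2π/n = π/N`.
  convert KCGraph.tendsto_eigenvalueSeq_div m (Nat.mul_pos two_pos hN) hθ using 2
  have hN' : (Γ.edgeFinset.card : ℝ) ≠ 0 := by exact_mod_cast hN.ne'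
  push_cast
  field_simp
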